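/- Let $p\ge 1$, let $f:\mathbb R\to\mathbb R$ be convex with $f(0)=0$, and let $Q\subseteq\{0,1\}^p$ be such that for every $i\in[p]=\{1,\dots,p\}$ there is $z\in Q$ with $z_i=1$. Put $$Z_Q=\{(z,\beta,t)\in Q\times\mathbb R^p\times\mathbb R \;:\; f(\mathbf 1^\top\beta)\le t,\ \beta_i(1-z_i)=0\ \text{for all } i\in[p]\},$$ where $\mathbf 1$ is the all-ones vector. Let $G_Q$ be the graph with vertex set $[p]$ in which distinct $i,j$ are adjacent if and only if $z_i=z_j=1$ for some $z\in Q$, and let $V_1,\dots,V_k$ be the vertex sets of its connected components. For $\ell\in[k]$ let $Q_\ell=\{z\in Q: z_i=0 \text{ for all } i\notin V_\ell\}$, let $A^\ell z\le\delta^\ell$ be any finite system of linear inequalities in $z\in\mathbb R^p$ with $\operatorname{conv}(Q_\ell)=\{z\in\mathbb R^p: A^\ell z\le\delta^\ell\}$, and let $\mathcal F_\ell\subseteq\mathbb R^p$ be any finite set such that $$\operatorname{conv}(Q_\ell\setminus\{\mathbf 0\})=\operatorname{conv}(Q_\ell)\cap\{z:\pi^\top z\ge 1\ \text{for all } \pi\in\mathcal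 F_\ell\}.$$ Adopt the convention $0f(x/0)=\lim_{s\to0^+}s f(x/s)\in\mathbb R\cup\{+\infty\}$. Then the closure of the convex hull of $Z_Q$ satisfies $$\begin{aligned}\operatorname{cl\,conv}(Z_Q)=\operatorname{proj}_{(z,\beta,t)}\Big\{&(z,\beta,\hat z,\hat\beta,\alpha,\hat t,t)\in[0,1]^p\times\mathbb R^p\times[0,1]^{pk}\times\mathbb R^{pk}\times\mathbb R_+^k\times\mathbb R^k\times\mathbb R \;:\\ &\sum_{\ell=1}^k\alpha_\ell=1,\quad t=\sum_{\ell=1}^k\hat t^\ell,\quad z=\sum_{\ell=1}^k\hat z^\ell,\quad \beta=\sum_{\ell=1}^k\hat\beta^\ell,\\ &\hat\beta^\ell_i=0\ \ \forall i\notin V_\ell,\quad A^\ell\hat z^\ell\le\delta^\ell\alpha_\ell,\quad \hat t^\ell\ge\alpha_\ell f\Big(\frac{\mathbf 1^\top\hat\beta^\ell}{\alpha_\ell}\Big)\quad\forall\ell\in[k],\\ &\hat t^\ell\ge(\pi^\top\hat z^\ell)f\Big(\frac{\mathbf 1^\top\hat\beta^\ell}{\pi^\top\hat z^\ell}\Big)\quad\forall\pi\in\mathcal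 F_\ell,\ \forall\ell\in[k]\Big\}.\end{aligned}$$ -/

import Mathlib

open Filter Topology

/-- The perspective `z f(x / z)` of `f : ℝ → ℝ` for `z > 0`, extended to `z = 0` by
`0 f(x / 0) = lim_{s → 0⁺} s f(x / s)`, a value in `ℝ ∪ {±∞}`. (The `limsup` is this limit:
see `tendsto_persp_zero`.) For `z < 0` the closure of the perspective function is `+∞`. -/
noncomputable def persp (f : ℝ → ℝ) (z x : ℝ) : EReal :=
  if 0 < z then ((z * f (x / z) : ℝ) : EReal)
  else if z = 0 then limsup (fun s : ℝ => ((s * f (x / s) : ℝ) : EReal)) (𝓝[>] 0)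
  else ⊤

/-- For a convex `f` with `f 0 = 0`, the limit that defines `0 f(x / 0)` exists. -/
theorem tendsto_persp_zero {f : ℝ → ℝ} (hf : ConvexOn ℝ Set.univ f) (hf0 : f 0 = 0) (x : ℝ) :
    Tendsto (fun s : ℝ => ((s * f (x / s) : ℝ) : EReal)) (𝓝[>] 0) (𝓝 (persp f 0 x)) := by
  have hanti : AntitoneOn (fun s : ℝ => ((s * f (x / s) : ℝ) : EReal)) (Set.Ioi 0) := by
    intro s hs t ht hst
    have hs' : (0 : ℝ) < s := hs
    have ht' : (0 : ℝ) < t := ht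
    have h := hf.2 (Set.mem_univ (x / s)) (Set.mem_univ (0 : ℝ))
      (show 0 ≤ s / t by positivity)
      (show 0 ≤ 1 - s / t by rw [sub_nonneg, div_le_one ht']; exact hst) (by ring)
    simp only [smul_eq_mul, mul_zero, add_zero, hf0] at h
    have he : s / t * (x / s) = x / t := by field_simp
    rw [he] at h
    refine EReal.coe_le_coe_iff.2 ?_
    calc t * f (x / t) ≤ t * (s / t * f (x / s)) := mul_le_mul_of_nonneg_left h ht'.le
      _ = s * f (x / s) := by field_simp
  have hlim : Tendsto (fun s : ℝ => ((s * f (x / s) : ℝ) : EReal)) (𝓝[>] 0)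
      (𝓝 (sSup ((fun s : ℝ => ((s * f (x / s) : ℝ) : EReal)) '' Set.Ioi 0))) :=
    hanti.tendsto_nhdsGT (OrderTop.bddAbove _)
  have hp : persp f 0 x = limsup (fun s : ℝ => ((s * f (x / s) : ℝ) : EReal)) (𝓝[>] 0) := by
    simp [persp]
  rw [hp, hlim.limsup_eq]
  exact hlim

/-- The mixed-integer epigraph
`Z_Q = {(z, β, t) ∈ Q × ℝᵖ × ℝ | f(1ᵀβ) ≤ t, βᵢ (1 - zᵢ) = 0 for all i}`. -/
def ZSet {p : ℕ} (f : ℝ → ℝ) (Q : Set (Fin p → ℝ)) :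
    Set ((Fin p → ℝ) × (Fin p → ℝ) × ℝ) :=
  {x | x.1 ∈ Q ∧ f (∑ i, x.2.1 i) ≤ x.2.2 ∧ ∀ i, x.2.1 i * (1 - x.1 i) = 0}

/-- The graph `G_Q` on the indices: `i ∼ j` iff `i ≠ j` and `zᵢ = zⱼ = 1` for some `z ∈ Q`. -/
def indexGraph {p : ℕ} (Q : Set (Fin p → ℝ)) : SimpleGraph (Fin p) where
  Adj i j := i ≠ j ∧ ∃ z ∈ Q, z i = 1 ∧ z j = 1
  symm := ⟨fun _ _ ⟨hne, z, hz, hi, hj⟩ => ⟨hne.symm, z, hz, hj, hi⟩⟩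
  loopless := ⟨fun _ h => h.1 rfl⟩

/-- `Q_V = {z ∈ Q | zᵢ = 0 for all i ∉ V}`. -/
def restrictTo {p : ℕ} (Q : Set (Fin p → ℝ)) (V : Set (Fin p)) : Set (Fin p → ℝ) :=
  {z | z ∈ Q ∧ ∀ i, i ∉ V → z i = 0}

/-- The variables `(z, β, ẑ, β̂, α, t̂, t)` of the extended formulation. -/
structure ExtVars (p k : ℕ) where
  z : Fin p → ℝ
  β : Fin p → ℝ
  zhat : Fin k → Fin p → ℝ
  βhat : Fin k → Fin p → ℝ
  α : Fin k → ℝ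
  that : Fin k → ℝ
  t : ℝ

/-- The projection onto the space of the variables `(z, β, t)`. -/
def ExtVars.proj {p k : ℕ} (x : ExtVars p k) : (Fin p → ℝ) × (Fin p → ℝ) × ℝ :=
  (x.z, x.β, x.t)

/-- The feasible set of the extended formulation with `k` blocks of indices `V ℓ`, linear
systems `A ℓ z ≤ δ ℓ`, and finite sets `F ℓ` of coefficient vectors `π`. The piece `β̂ ℓ` is a
vector of the coordinates in `V ℓ`, that is, a vector of `ℝᵖ` that vanishes outside `V ℓ`. -/
def extendedFormulation {p k : ℕ} (f : ℝ → ℝ) (V : Fin k → Set (Fin p)) {m : Fin k → ℕ}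
    (A : ∀ ℓ, Matrix (Fin (m ℓ)) (Fin p) ℝ) (δ : ∀ ℓ, Fin (m ℓ) → ℝ)
    (F : Fin k → Finset (Fin p → ℝ)) : Set (ExtVars p k) :=
  {x | (∀ i, x.z i ∈ Set.Icc (0 : ℝ) 1) ∧
    (∀ ℓ i, x.zhat ℓ i ∈ Set.Icc (0 : ℝ) 1) ∧
    (∀ ℓ, 0 ≤ x.α ℓ) ∧
    (∀ ℓ i, i ∉ V ℓ → x.βhat ℓ i = 0) ∧
    ∑ ℓ, x.α ℓ = 1 ∧
    x.t = ∑ ℓ, x.that ℓ ∧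
    x.z = ∑ ℓ, x.zhat ℓ ∧
    x.β = ∑ ℓ, x.βhat ℓ ∧
    (∀ ℓ, Matrix.mulVec (A ℓ) (x.zhat ℓ) ≤ x.α ℓ • δ ℓ) ∧
    (∀ ℓ, persp f (x.α ℓ) (∑ i, x.βhat ℓ i) ≤ (x.that ℓ : EReal)) ∧
    (∀ ℓ, ∀ π ∈ F ℓ,
      persp f (∑ i, π i * x.zhat ℓ i) (∑ i, x.βhat ℓ i) ≤ (x.that ℓ : EReal))}

/-!
The proof rests on two structural facts and a reduction of each block to a one-dimensional
question.

*The perspective is a supremum of linear functions.* For convex `f` with `f 0 = 0`,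
`persp f z x ≤ t` holds iff `0 ≤ z` and `a x + b z ≤ t` for every affine minorant `a y + b` of `f`
(`persp_le_coe_iff`). So the epigraph of the perspective is a closed convex cone, and, since
`b ≤ f 0 = 0`, the perspective is antitone in `z`. Hence the feasible set of the extended
formulation is closed and convex. Its projection is convex, and it is closed as well because the
projection is proper on the feasible set (`isCompact_blocks_inter`): `ẑ` and `α` are bounded, the
blocks `β̂ ℓ` are restrictions of `β` to disjoint sets, and a linear minorant of `f` bounds the
`t̂ ℓ` from below while their sum is `t`. As every point of `Z_Q` lies in the projection
(`ZSet_subset_proj`), so does the closed convex hull.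

*The closed convex hull `C` recedes in many directions.* If `zᵢ = zⱼ = 1` for some `z ∈ Q`, then
`C` recedes in the directions `(0, a (eⱼ - eᵢ), 0)`; along paths of the graph this allows mass of
`β` to be moved freely within a component (`mem_recession_of_sum`). Likewise `C` recedes in the
direction `(0, β, t)` if `β` lives on one component and `persp f 0 (1ᵀβ) ≤ t`
(`mem_recession_of_persp_zero`). So only the total `y = 1ᵀβ` of a block matters.

For the converse inclusion, a block with `α ℓ > 0` can be scaled to `α ℓ = 1`. Then `ẑ = s w` with
`w ∈ conv (Q_ℓ \ {0})`, and `s` can be taken at least `min {1, πᵀẑ : π ∈ F ℓ}`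
(`exists_smul_mem_convexHull_diff`), so that `s f(y / s) ≤ t̂`; the block is `s` times a point over
`w` plus `1 - s` times the origin, up to recession directions (`mem_closure_of_block`). A block with
`α ℓ = 0` has `ẑ = 0`, because `conv Q_ℓ` is bounded, and is itself a recession direction. A point
of the extended formulation is thus a convex combination of points of `C` plus recession directions.
-/

/-! ### The perspective as a supremum of affine functions -/

theorem ConvexOn.exists_subgradient {f : ℝ → ℝ} (hf : ConvexOn ℝ Set.univ f) (x : ℝ) :
    ∃ a, ∀ y, f x + a * (y - x) ≤ f y := by
  have hx : x ∈ interior (Set.univ : Set ℝ) := by simp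
  refine ⟨derivWithin f (Set.Ioi x) x, fun y => ?_⟩
  rcases lt_trichotomy x y with h | rfl | h
  · have := hf.rightDeriv_le_slope_of_mem_interior hx (Set.mem_univ y) h
    rw [slope_def_field, le_div_iff₀ (sub_pos.2 h)] at this
    linarith
  · simp
  · have := (hf.slope_le_leftDeriv_of_mem_interior (Set.mem_univ y) hx h).trans
      (hf.leftDeriv_le_rightDeriv_of_mem_interior hx)
    rw [slope_def_field, div_le_iff₀ (sub_pos.2 h)] at this
    linarith

/-- The pairs `(a, b)` for which the affine function `y ↦ a y + b` lies below `f`. -/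
def affineMinorants (f : ℝ → ℝ) : Set (ℝ × ℝ) :=
  {c | ∀ y, c.1 * y + c.2 ≤ f y}

/-- The epigraph of the perspective is cut out by one closed halfspace for each affine minorant
of `f`. This makes it visibly a closed convex cone. -/
theorem persp_le_coe_iff {f : ℝ → ℝ} (hf : ConvexOn ℝ Set.univ f) (hf0 : f 0 = 0) {z x t : ℝ} :
    persp f z x ≤ (t : EReal) ↔ 0 ≤ z ∧ ∀ c ∈ affineMinorants f, c.1 * x + c.2 * z ≤ t := by
  rcases lt_trichotomy z 0 with hz | rfl | hz
  · simp [persp, hz.not_gt, hz.ne, hz.not_ge]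
  · have hlim := tendsto_persp_zero hf hf0 x
    simp only [le_refl, mul_zero, add_zero, true_and]
    constructor
    · intro h c hc
      have h1 : Tendsto (fun s : ℝ => ((c.1 * x + c.2 * s : ℝ) : EReal)) (𝓝[>] 0)
          (𝓝 ((c.1 * x : ℝ) : EReal)) := by
        refine (continuous_coe_real_ereal.tendsto _).comp (Tendsto.mono_left ?_ nhdsWithin_le_nhds)
        have : Continuous fun s : ℝ => c.1 * x + c.2 * s := by fun_prop
        simpa using this.tendsto 0
      have h2 := le_of_tendsto_of_tendsto h1 hlim (by
        filter_upwards [self_mem_nhdsWithin] with s hs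
        have hs : (0 : ℝ) < s := hs
        refine EReal.coe_le_coe_iff.2 ?_
        calc c.1 * x + c.2 * s = s * (c.1 * (x / s) + c.2) := by field_simp
          _ ≤ _ := mul_le_mul_of_nonneg_left (hc _) hs.le)
      exact EReal.coe_le_coe_iff.1 (h2.trans h)
    · intro h
      refine le_of_tendsto hlim ?_
      filter_upwards [self_mem_nhdsWithin] with s hs
      have hs : (0 : ℝ) < s := hs
      refine EReal.coe_le_coe_iff.2 ?_
      obtain ⟨a, ha⟩ := hf.exists_subgradient (x / s)
      have h1 := h (a, f (x / s) - a * (x / s)) fun y => by linarith [ha y]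
      have h2 := ha 0
      rw [hf0] at h2
      calc s * f (x / s) = s * (f (x / s) + a * (0 - x / s)) + a * x := by field_simp; ring
        _ ≤ s * 0 + a * x := by gcongr
        _ ≤ t := by simpa using h1
  · simp only [persp, hz, if_true, hz.le, true_and, EReal.coe_le_coe_iff]
    constructor
    · intro h c hc
      calc c.1 * x + c.2 * z = z * (c.1 * (x / z) + c.2) := by field_simp
        _ ≤ z * f (x / z) := mul_le_mul_of_nonneg_left (hc _) hz.le
        _ ≤ t := h
    · intro h
      obtain ⟨a, ha⟩ := hf.exists_subgradient (x / z)
      have h1 := h (a, f (x / z) - a * (x / z)) fun y => by linarith [ha y]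
      calc z * f (x / z) = a * x + (f (x / z) - a * (x / z)) * z := by field_simp; ring
        _ ≤ t := h1

theorem persp_one (f : ℝ → ℝ) (x : ℝ) : persp f 1 x = (f x : EReal) := by
  simp [persp]

theorem persp_le_coe_of_le {f : ℝ → ℝ} (hf : ConvexOn ℝ Set.univ f) (hf0 : f 0 = 0)
    {z z' x t : ℝ} (hz : z ≤ z') (h : persp f z x ≤ (t : EReal)) :
    persp f z' x ≤ (t : EReal) := by
  rw [persp_le_coe_iff hf hf0] at h ⊢
  refine ⟨h.1.trans hz, fun c hc => ?_⟩
  have hc0 : c.2 ≤ 0 := by simpa [hf0] using hc 0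
  linarith [h.2 c hc, mul_le_mul_of_nonpos_left hz hc0]

theorem persp_mul_le_coe {f : ℝ → ℝ} (hf : ConvexOn ℝ Set.univ f) (hf0 : f 0 = 0)
    {r z x t : ℝ} (hr : 0 ≤ r) (h : persp f z x ≤ (t : EReal)) :
    persp f (r * z) (r * x) ≤ ((r * t : ℝ) : EReal) := by
  rw [persp_le_coe_iff hf hf0] at h ⊢
  refine ⟨mul_nonneg hr h.1, fun c hc => ?_⟩
  linarith [mul_le_mul_of_nonneg_left (h.2 c hc) hr]

theorem persp_add_le_coe {f : ℝ → ℝ} (hf : ConvexOn ℝ Set.univ f) (hf0 : f 0 = 0)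
    {z x t z' x' t' : ℝ} (h : persp f z x ≤ (t : EReal)) (h' : persp f z' x' ≤ (t' : EReal)) :
    persp f (z + z') (x + x') ≤ ((t + t' : ℝ) : EReal) := by
  rw [persp_le_coe_iff hf hf0] at h h' ⊢
  refine ⟨add_nonneg h.1 h'.1, fun c hc => ?_⟩
  linarith [h.2 c hc, h'.2 c hc]

theorem persp_zero_zero_le_coe {f : ℝ → ℝ} (hf : ConvexOn ℝ Set.univ f) (hf0 : f 0 = 0)
    {t : ℝ} (ht : 0 ≤ t) : persp f 0 0 ≤ (t : EReal) := by
  rw [persp_le_coe_iff hf hf0]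
  exact ⟨le_rfl, fun c _ => by simpa using ht⟩

theorem isClosed_setOf_persp_le {f : ℝ → ℝ} (hf : ConvexOn ℝ Set.univ f) (hf0 : f 0 = 0)
    {X : Type*} [TopologicalSpace X] {z x t : X → ℝ} (hz : Continuous z) (hx : Continuous x)
    (ht : Continuous t) : IsClosed {w | persp f (z w) (x w) ≤ (t w : EReal)} := by
  simp only [persp_le_coe_iff hf hf0, Set.ofPred_and, Set.ofPred_forall]
  refine (isClosed_le continuous_const hz).inter (isClosed_iInter fun c => isClosed_iInter
    fun _ => isClosed_le (by fun_prop) ht)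

/-! ### Recession directions -/

/-- The directions `d` in which `C` recedes: `C + d ⊆ C`. For closed convex `C` this is the
recession cone; only its additivity is needed. -/
def recessionDirections {E : Type*} [AddCommMonoid E] (C : Set E) : AddSubmonoid E where
  carrier := {d | ∀ c ∈ C, c + d ∈ C}
  zero_mem' := fun c hc => by simpa using hc
  add_mem' := fun {a b} ha hb c hc => by simpa [add_assoc] using hb _ (ha c hc)

/-- If `s • c s ∈ s • C` converges to `d` as `s → 0⁺`, then `C` recedes in direction `d`. -/
theorem mem_recessionDirections_of_tendsto {E : Type*} [AddCommGroup E] [Module ℝ E]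
    [TopologicalSpace E] [ContinuousAdd E] [ContinuousSMul ℝ E] {C : Set E} (hC : Convex ℝ C)
    (hcl : IsClosed C) {d : E} {c : ℝ → E} (hc : ∀ s, 0 < s → c s ∈ C)
    (h : Tendsto (fun s => s • c s) (𝓝[>] (0 : ℝ)) (𝓝 d)) : d ∈ recessionDirections C := by
  intro x hx
  have h1 : Tendsto (fun s : ℝ => (1 - s) • x) (𝓝[>] (0 : ℝ)) (𝓝 x) := by
    have : Continuous fun s : ℝ => (1 - s) • x := by fun_prop
    simpa using (this.tendsto 0).mono_left nhdsWithin_le_nhds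
  refine hcl.mem_of_tendsto (h1.add h) ?_
  filter_upwards [Ioo_mem_nhdsGT (zero_lt_one (α := ℝ))] with s hs
  exact hC hx (hc s hs.1) (by linarith [hs.2]) hs.1.le (by ring)

/-! ### The extended formulation: its projection is closed and convex -/

/-- The point of the extended formulation with blocks `(ẑ, β̂, α, t̂)`: the aggregate variables
`z`, `β`, `t` are the sums of their blocks. -/
def ExtVars.ofBlocks {p k : ℕ}
    (w : (Fin k → Fin p → ℝ) × (Fin k → Fin p → ℝ) × (Fin k → ℝ) × (Fin k → ℝ)) :
    ExtVars p k where
  z := ∑ ℓ, w.1 ℓ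
  β := ∑ ℓ, w.2.1 ℓ
  zhat := w.1
  βhat := w.2.1
  α := w.2.2.1
  that := w.2.2.2
  t := ∑ ℓ, w.2.2.2 ℓ

section
variable {p k : ℕ} {f : ℝ → ℝ} {V : Fin k → Set (Fin p)} {m : Fin k → ℕ}
  {A : ∀ ℓ, Matrix (Fin (m ℓ)) (Fin p) ℝ} {δ : ∀ ℓ, Fin (m ℓ) → ℝ}
  {F : Fin k → Finset (Fin p → ℝ)}

theorem proj_image_extendedFormulation :
    ExtVars.proj '' extendedFormulation f V A δ F =
      (fun w => (ExtVars.ofBlocks w).proj) ''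
        (ExtVars.ofBlocks ⁻¹' extendedFormulation f V A δ F) := by
  apply Set.Subset.antisymm
  · rintro _ ⟨x, hx, rfl⟩
    have hw : ExtVars.ofBlocks (x.zhat, x.βhat, x.α, x.that) = x := by
      obtain ⟨-, -, -, -, -, ht, hz, hβ, -⟩ := hx
      cases x
      simp_all [ExtVars.ofBlocks]
    exact ⟨(x.zhat, x.βhat, x.α, x.that), by rwa [Set.mem_preimage, hw],
      congrArg ExtVars.proj hw⟩
  · rintro _ ⟨w, hw, rfl⟩
    exact ⟨_, hw, rfl⟩

theorem isClosed_blocks (hf : ConvexOn ℝ Set.univ f) (hf0 : f 0 = 0) :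
    IsClosed (ExtVars.ofBlocks ⁻¹' extendedFormulation f V A δ F) := by
  simp only [extendedFormulation, Set.ofPred_and, Set.ofPred_forall, Set.preimage_inter,
    Set.preimage_iInter, Set.preimage_ofPred_eq, ExtVars.ofBlocks]
  refine IsClosed.inter (isClosed_iInter fun i => isClosed_Icc.preimage (by fun_prop)) <|
    IsClosed.inter (isClosed_iInter fun ℓ => isClosed_iInter fun i =>
      isClosed_Icc.preimage (by fun_prop)) <|
    IsClosed.inter (isClosed_iInter fun ℓ => isClosed_le (by fun_prop) (by fun_prop)) <|
    IsClosed.inter (isClosed_iInter fun ℓ => isClosed_iInter fun i => isClosed_iInter fun _ =>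
      isClosed_eq (by fun_prop) (by fun_prop)) <|
    IsClosed.inter (isClosed_eq (by fun_prop) (by fun_prop)) <|
    IsClosed.inter isClosed_const <|
    IsClosed.inter isClosed_const <|
    IsClosed.inter isClosed_const <|
    IsClosed.inter (isClosed_iInter fun ℓ => isClosed_le
      (Continuous.matrix_mulVec continuous_const (by fun_prop)) (by fun_prop)) <|
    IsClosed.inter (isClosed_iInter fun ℓ => isClosed_setOf_persp_le hf hf0
      (by fun_prop) (by fun_prop) (by fun_prop)) <|
    (isClosed_iInter fun ℓ => isClosed_iInter fun π => isClosed_iInter fun _ =>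
      isClosed_setOf_persp_le hf hf0 (by fun_prop) (by fun_prop) (by fun_prop))

theorem convex_blocks (hf : ConvexOn ℝ Set.univ f) (hf0 : f 0 = 0) :
    Convex ℝ (ExtVars.ofBlocks ⁻¹' extendedFormulation f V A δ F) := by
  rintro w ⟨h1, h2, h3, h4, h5, h6, h7, h8, h9, h10, h11⟩
    w' ⟨g1, g2, g3, g4, g5, g6, g7, g8, g9, g10, g11⟩ a b ha hb hab
  have hpersp : ∀ {z x t z' x' t' : ℝ}, persp f z x ≤ (t : EReal) →
      persp f z' x' ≤ (t' : EReal) →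
      persp f (a * z + b * z') (a * x + b * x') ≤ ((a * t + b * t' : ℝ) : EReal) :=
    fun h h' => persp_add_le_coe hf hf0 (persp_mul_le_coe hf hf0 ha h)
      (persp_mul_le_coe hf hf0 hb h')
  simp only [ExtVars.ofBlocks] at h1 h2 h3 h4 h5 h9 h10 h11 g1 g2 g3 g4 g5 g9 g10 g11
  refine ⟨?_, ?_, ?_, ?_, ?_, rfl, rfl, rfl, ?_, ?_, ?_⟩ <;>
    simp only [ExtVars.ofBlocks, Prod.fst_add, Prod.snd_add, Prod.smul_fst, Prod.smul_snd]
  · intro i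
    have := (convex_Icc (0 : ℝ) 1) (h1 i) (g1 i) ha hb hab
    simpa [Finset.sum_apply, Finset.sum_add_distrib, Finset.mul_sum] using this
  · intro ℓ i
    exact (convex_Icc (0 : ℝ) 1) (h2 ℓ i) (g2 ℓ i) ha hb hab
  · intro ℓ
    exact add_nonneg (mul_nonneg ha (h3 ℓ)) (mul_nonneg hb (g3 ℓ))
  · intro ℓ i hi
    simp [h4 ℓ i hi, g4 ℓ i hi]
  · simp [Finset.sum_add_distrib, ← Finset.mul_sum, h5, g5, hab]
  · intro ℓ i
    have h := mul_le_mul_of_nonneg_left (h9 ℓ i) ha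
    have g := mul_le_mul_of_nonneg_left (g9 ℓ i) hb
    simp only [Pi.add_apply, Pi.smul_apply, Matrix.mulVec_add, Matrix.mulVec_smul,
      smul_eq_mul] at h g ⊢
    linarith
  · intro ℓ
    have := hpersp (h10 ℓ) (g10 ℓ)
    simpa [Finset.sum_add_distrib, ← Finset.mul_sum] using this
  · intro ℓ π hπ
    have := hpersp (h11 ℓ π hπ) (g11 ℓ π hπ)
    simpa [Finset.sum_add_distrib, Finset.mul_sum, mul_add, mul_left_comm] using this

/-- The block `β̂ ℓ` is the restriction of `β` to `V ℓ`, as the index blocks are disjoint. -/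
theorem sum_eq_of_disjoint_blocks (hV : Pairwise fun ℓ ℓ' => Disjoint (V ℓ) (V ℓ'))
    {b : Fin k → Fin p → ℝ} (hb : ∀ ℓ i, i ∉ V ℓ → b ℓ i = 0) {ℓ : Fin k} {i : Fin p}
    (hi : i ∈ V ℓ) : (∑ ℓ', b ℓ') i = b ℓ i := by
  rw [Finset.sum_apply]
  refine Finset.sum_eq_single ℓ (fun ℓ' _ hne => hb _ _ fun hi' => ?_) (by simp)
  exact Set.disjoint_left.1 (hV hne) hi' hi

/-- The projection is proper on the feasible set: bounds on `β` and `t` bound all the blocks.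
Here a linear minorant `a y ≤ f y` keeps every `t̂ ℓ` from running off to `-∞`, and hence, the sum
being `t`, also from running off to `+∞`. -/
theorem isCompact_blocks_inter (hf : ConvexOn ℝ Set.univ f) (hf0 : f 0 = 0)
    (hV : Pairwise fun ℓ ℓ' => Disjoint (V ℓ) (V ℓ')) (c : (Fin p → ℝ) × (Fin p → ℝ) × ℝ) :
    IsCompact (ExtVars.ofBlocks ⁻¹' extendedFormulation f V A δ F ∩
      (fun w => (ExtVars.ofBlocks w).proj) ⁻¹' Metric.closedBall c 1) := by
  obtain ⟨a, ha⟩ := hf.exists_subgradient 0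
  have hmin : (a, (0 : ℝ)) ∈ affineMinorants f := fun y => by
    simpa [hf0] using ha y
  set B : ℝ := ‖c‖ + 1
  set N : ℝ := |a| * (p * B)
  have hcont : Continuous fun w : (Fin k → Fin p → ℝ) × (Fin k → Fin p → ℝ) ×
      (Fin k → ℝ) × (Fin k → ℝ) => (ExtVars.ofBlocks w).proj := by
    unfold ExtVars.ofBlocks ExtVars.proj
    fun_prop
  refine IsCompact.of_isClosed_subset (s := Set.Icc
      (fun _ _ => 0, fun _ _ => -B, fun _ => 0, fun _ => -N)
      (fun _ _ => 1, fun _ _ => B, fun _ => 1, fun _ => B + 2 * N)) isCompact_Icc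
    ((isClosed_blocks hf hf0).inter (Metric.isClosed_closedBall.preimage hcont)) ?_
  rintro ⟨zh, βh, α, th⟩ ⟨⟨-, h2, h3, h4, h5, -, -, -, -, h10, -⟩, hball⟩
  simp only [ExtVars.ofBlocks] at h2 h3 h4 h5 h10
  have hB0 : 0 ≤ B := by positivity
  have hnorm : ‖((ExtVars.ofBlocks (zh, βh, α, th)).proj)‖ ≤ B := by
    have := norm_le_norm_add_norm_sub' (ExtVars.ofBlocks (zh, βh, α, th)).proj c
    have h := mem_closedBall_iff_norm.1 hball
    simp only [B]
    linarith
  have hβ : ∀ i, |(∑ ℓ, βh ℓ) i| ≤ B := fun i =>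
    (norm_le_pi_norm (∑ ℓ, βh ℓ) i).trans
      (((norm_fst_le _).trans (norm_snd_le (ExtVars.ofBlocks (zh, βh, α, th)).proj)).trans hnorm)
  have ht : |∑ ℓ, th ℓ| ≤ B :=
    ((norm_snd_le _).trans (norm_snd_le (ExtVars.ofBlocks (zh, βh, α, th)).proj)).trans hnorm
  have hβh : ∀ ℓ i, |βh ℓ i| ≤ B := fun ℓ i => by
    by_cases hi : i ∈ V ℓ
    · rw [← sum_eq_of_disjoint_blocks hV h4 hi]
      exact hβ i
    · rw [h4 ℓ i hi, abs_zero]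
      exact hB0
  have hsum : ∀ b : Fin p → ℝ, (∀ i, |b i| ≤ B) → |a * ∑ i, b i| ≤ N := fun b hb => by
    rw [abs_mul]
    refine mul_le_mul_of_nonneg_left ((Finset.abs_sum_le_sum_abs _ _).trans ?_) (abs_nonneg a)
    simpa using Finset.sum_le_sum fun i (_ : i ∈ Finset.univ) => hb i
  have hlow : ∀ ℓ, a * ∑ i, βh ℓ i ≤ th ℓ := fun ℓ => by
    simpa using ((persp_le_coe_iff hf hf0).1 (h10 ℓ)).2 _ hmin
  have hup : ∀ ℓ, th ℓ - a * ∑ i, βh ℓ i ≤ B + N := fun ℓ => by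
    have h := Finset.single_le_sum (f := fun ℓ => th ℓ - a * ∑ i, βh ℓ i)
      (fun ℓ _ => sub_nonneg.2 (hlow ℓ)) (Finset.mem_univ ℓ)
    refine h.trans ?_
    rw [Finset.sum_sub_distrib, ← Finset.mul_sum, Finset.sum_comm]
    have h' := hsum _ hβ
    simp only [Finset.sum_apply] at h'
    linarith [abs_le.1 ht, abs_le.1 h']
  have hα : ∀ ℓ, α ℓ ≤ 1 := fun ℓ =>
    h5 ▸ Finset.single_le_sum (fun ℓ _ => h3 ℓ) (Finset.mem_univ ℓ)
  refine ⟨⟨fun ℓ i => (h2 ℓ i).1, fun ℓ i => (abs_le.1 (hβh ℓ i)).1, h3, fun ℓ => ?_⟩,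
    ⟨fun ℓ i => (h2 ℓ i).2, fun ℓ i => (abs_le.1 (hβh ℓ i)).2, hα, fun ℓ => ?_⟩⟩
  · show -N ≤ th ℓ
    linarith [hlow ℓ, abs_le.1 (hsum _ (hβh ℓ))]
  · show th ℓ ≤ B + 2 * N
    linarith [hup ℓ, abs_le.1 (hsum _ (hβh ℓ))]

theorem isClosed_proj_extendedFormulation (hf : ConvexOn ℝ Set.univ f) (hf0 : f 0 = 0)
    (hV : Pairwise fun ℓ ℓ' => Disjoint (V ℓ) (V ℓ')) :
    IsClosed (ExtVars.proj '' extendedFormulation f V A δ F) := by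
  rw [proj_image_extendedFormulation]
  refine isClosed_of_closure_subset fun c hc => ?_
  have hcont : Continuous fun w : (Fin k → Fin p → ℝ) × (Fin k → Fin p → ℝ) ×
      (Fin k → ℝ) × (Fin k → ℝ) => (ExtVars.ofBlocks w).proj := by
    unfold ExtVars.ofBlocks ExtVars.proj
    fun_prop
  have h := (mem_closure_iff_nhds.1 hc)
  have hcl := ((isCompact_blocks_inter (A := A) (δ := δ) (F := F) hf hf0 hV c).image
    hcont).isClosed
  have : c ∈ closure ((fun w => (ExtVars.ofBlocks w).proj) ''
      (ExtVars.ofBlocks ⁻¹' extendedFormulation f V A δ F ∩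
        (fun w => (ExtVars.ofBlocks w).proj) ⁻¹' Metric.closedBall c 1)) := by
    refine mem_closure_iff_nhds.2 fun U hU => ?_
    obtain ⟨_, ⟨hyU, hyB⟩, w, hw, rfl⟩ :=
      h _ (inter_mem hU (Metric.closedBall_mem_nhds c one_pos))
    exact ⟨_, hyU, w, ⟨hw, hyB⟩, rfl⟩
  rw [hcl.closure_eq] at this
  exact Set.image_mono Set.inter_subset_left this

theorem convex_proj_extendedFormulation (hf : ConvexOn ℝ Set.univ f) (hf0 : f 0 = 0) :
    Convex ℝ (ExtVars.proj '' extendedFormulation f V A δ F) := by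
  rw [proj_image_extendedFormulation]
  refine (convex_blocks hf hf0).is_linear_image ⟨fun x y => ?_, fun r x => ?_⟩
  · simp [ExtVars.ofBlocks, ExtVars.proj, Finset.sum_add_distrib]
  · simp [ExtVars.ofBlocks, ExtVars.proj, Finset.smul_sum, Finset.mul_sum]

end

/-! ### Components of the index graph -/

section
variable {p : ℕ} {f : ℝ → ℝ} {Q : Set (Fin p → ℝ)}

/-- The support of a point of `Q` is a clique of the index graph, so it lies in the component of
any of its elements. -/
theorem mem_restrictTo_supp (hQ : ∀ z ∈ Q, ∀ i, z i = 0 ∨ z i = 1) {z : Fin p → ℝ} (hz : z ∈ Q)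
    {c : (indexGraph Q).ConnectedComponent} {i : Fin p} (hi : z i = 1) (hc : i ∈ c.supp) :
    z ∈ restrictTo Q c.supp := by
  refine ⟨hz, fun j hj => (hQ z hz j).resolve_right fun hj1 => hj ?_⟩
  rcases eq_or_ne j i with rfl | hne
  · exact hc
  · rw [SimpleGraph.ConnectedComponent.mem_supp_iff] at hc ⊢
    rw [← hc, SimpleGraph.ConnectedComponent.eq]
    exact SimpleGraph.Adj.reachable ⟨hne, z, hz, hj1, hi⟩

theorem eq_one_of_mem_restrictTo_diff (hQ : ∀ z ∈ Q, ∀ i, z i = 0 ∨ z i = 1) {V : Set (Fin p)}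
    {z : Fin p → ℝ} (hz : z ∈ restrictTo Q V \ {0}) : ∃ i ∈ V, z i = 1 := by
  obtain ⟨⟨hzQ, hz0⟩, hne⟩ := hz
  obtain ⟨i, hi⟩ := Function.ne_iff.1 (show z ≠ 0 from hne)
  exact ⟨i, by_contra fun h => hi (hz0 i h), (hQ z hzQ i).resolve_left hi⟩

theorem zero_notMem_convexHull_restrictTo_diff (hQ : ∀ z ∈ Q, ∀ i, z i = 0 ∨ z i = 1)
    {V : Set (Fin p)} : (0 : Fin p → ℝ) ∉ convexHull ℝ (restrictTo Q V \ {0}) := by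
  intro h
  have hsub : convexHull ℝ (restrictTo Q V \ {0}) ⊆ {z | 1 ≤ ∑ i, z i} := by
    refine convexHull_min (fun z hz => ?_)
      (convex_halfSpace_ge ⟨fun x y => by simp [Finset.sum_add_distrib],
        fun r x => by simp [Finset.mul_sum]⟩ 1)
    obtain ⟨i, -, hi⟩ := eq_one_of_mem_restrictTo_diff hQ hz
    refine hi.symm.le.trans (Finset.single_le_sum (fun j _ => ?_) (Finset.mem_univ i))
    rcases hQ z hz.1.1 j with h | h <;> simp [h]
  have := hsub h
  norm_num at this

/-! ### Recession directions of the closed convex hull -/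

theorem isClosed_closure_convexHull_ZSet : IsClosed (closure (convexHull ℝ (ZSet f Q))) :=
  isClosed_closure

theorem convex_closure_convexHull_ZSet : Convex ℝ (closure (convexHull ℝ (ZSet f Q))) :=
  (convex_convexHull ℝ _).closure

theorem subset_closure_convexHull_ZSet : ZSet f Q ⊆ closure (convexHull ℝ (ZSet f Q)) :=
  (subset_convexHull ℝ _).trans subset_closure

/-- Along a fixed `z ∈ Q`, the points `(z, β / s, t / s)` of `Z_Q` escape to infinity in the
direction `(0, β, t)`. -/
theorem mem_recession_of_mem (hf : ConvexOn ℝ Set.univ f) (hf0 : f 0 = 0) {z β : Fin p → ℝ}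
    {t : ℝ} (hz : z ∈ Q) (hβ : ∀ i, β i * (1 - z i) = 0)
    (ht : persp f 0 (∑ i, β i) ≤ (t : EReal)) :
    (0, β, t) ∈ recessionDirections (closure (convexHull ℝ (ZSet f Q))) := by
  refine mem_recessionDirections_of_tendsto convex_closure_convexHull_ZSet
    isClosed_closure_convexHull_ZSet (c := fun s => (z, s⁻¹ • β, s⁻¹ * t)) (fun s hs => ?_) ?_
  · refine subset_closure_convexHull_ZSet ⟨hz, ?_, fun i => ?_⟩
    · have h := persp_le_coe_of_le hf hf0 (by simp : s⁻¹ * 0 ≤ 1)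
        (persp_mul_le_coe hf hf0 (inv_nonneg.2 hs.le) ht)
      rw [persp_one, EReal.coe_le_coe_iff] at h
      simpa [Finset.mul_sum] using h
    · simp [mul_assoc, hβ i]
  · have h1 : Tendsto (fun s : ℝ => ((s • z, β, t) : (Fin p → ℝ) × (Fin p → ℝ) × ℝ)) (𝓝[>] 0)
        (𝓝 (0, β, t)) := by
      have : Continuous fun s : ℝ => ((s • z, β, t) : (Fin p → ℝ) × (Fin p → ℝ) × ℝ) := by
        fun_prop
      simpa using (this.tendsto 0).mono_left nhdsWithin_le_nhds
    refine h1.congr' ?_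
    filter_upwards [self_mem_nhdsWithin] with s hs
    have hs : s ≠ 0 := ne_of_gt hs
    simp [smul_smul, hs]

/-- Mass of `β` may be moved between indices of one component: along an edge this is the recession
direction `(0, a (eⱼ - eᵢ), 0)` of a point of `Q` with `zᵢ = zⱼ = 1`. -/
theorem mem_recession_of_reachable (hf : ConvexOn ℝ Set.univ f) (hf0 : f 0 = 0)
    {i j : Fin p} (h : (indexGraph Q).Reachable i j) (a : ℝ) :
    ((0, Pi.single j a - Pi.single i a, 0) : (Fin p → ℝ) × (Fin p → ℝ) × ℝ) ∈
      recessionDirections (closure (convexHull ℝ (ZSet f Q))) := by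
  obtain ⟨w⟩ := h
  induction w with
  | nil =>
    rw [sub_self]
    exact zero_mem (recessionDirections (closure (convexHull ℝ (ZSet f Q))))
  | @cons u v w' hadj _ ih =>
    obtain ⟨-, z, hz, hu, hv⟩ := hadj
    have h1 : ((0, Pi.single v a - Pi.single u a, 0) : (Fin p → ℝ) × (Fin p → ℝ) × ℝ) ∈
        recessionDirections (closure (convexHull ℝ (ZSet f Q))) := by
      refine mem_recession_of_mem hf hf0 hz (fun i => ?_) ?_
      · by_cases hi : z i = 1
        · simp [hi]
        · have hiu : i ≠ u := fun h => hi (h ▸ hu)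
          have hiv : i ≠ v := fun h => hi (h ▸ hv)
          simp [hiu, hiv]
      · simpa [Finset.sum_sub_distrib] using persp_zero_zero_le_coe hf hf0 le_rfl
    simpa using add_mem h1 ih

theorem mem_recession_of_sum (hf : ConvexOn ℝ Set.univ f) (hf0 : f 0 = 0)
    {c : (indexGraph Q).ConnectedComponent} {i : Fin p} (hi : i ∈ c.supp) {β : Fin p → ℝ}
    (hβ : ∀ j, j ∉ c.supp → β j = 0) :
    ((0, β - Pi.single i (∑ j, β j), 0) : (Fin p → ℝ) × (Fin p → ℝ) × ℝ) ∈
      recessionDirections (closure (convexHull ℝ (ZSet f Q))) := by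
  have h : ∑ j, ((0, Pi.single j (β j) - Pi.single i (β j), 0) :
      (Fin p → ℝ) × (Fin p → ℝ) × ℝ) ∈
      recessionDirections (closure (convexHull ℝ (ZSet f Q))) := by
    refine sum_mem fun j _ => ?_
    by_cases hj : j ∈ c.supp
    · refine mem_recession_of_reachable hf hf0 ?_ _
      rw [← SimpleGraph.ConnectedComponent.eq]
      rw [SimpleGraph.ConnectedComponent.mem_supp_iff] at hi hj
      rw [hi, hj]
    · rw [hβ j hj, Pi.single_zero, Pi.single_zero, sub_self]
      exact zero_mem (recessionDirections (closure (convexHull ℝ (ZSet f Q))))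
  convert h using 1
  refine Prod.ext_iff.2 ⟨?_, Prod.ext_iff.2 ⟨?_, ?_⟩⟩
  · simp [Prod.fst_sum]
  · ext j
    simp [Prod.fst_sum, Prod.snd_sum, Finset.sum_apply, Finset.sum_sub_distrib, Pi.single_apply]
  · simp [Prod.snd_sum]

theorem mem_recession_of_persp_zero (hf : ConvexOn ℝ Set.univ f) (hf0 : f 0 = 0)
    (hcover : ∀ i, ∃ z ∈ Q, z i = 1)
    {c : (indexGraph Q).ConnectedComponent} {β : Fin p → ℝ} {t : ℝ}
    (hβ : ∀ j, j ∉ c.supp → β j = 0) (ht : persp f 0 (∑ j, β j) ≤ (t : EReal)) :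
    ((0, β, t) : (Fin p → ℝ) × (Fin p → ℝ) × ℝ) ∈
      recessionDirections (closure (convexHull ℝ (ZSet f Q))) := by
  obtain ⟨i, hi⟩ := c.nonempty_supp
  obtain ⟨z, hz, hzi⟩ := hcover i
  have h1 : ((0, Pi.single i (∑ j, β j), t) : (Fin p → ℝ) × (Fin p → ℝ) × ℝ) ∈
      recessionDirections (closure (convexHull ℝ (ZSet f Q))) := by
    refine mem_recession_of_mem hf hf0 hz (fun j => ?_) (by simpa using ht)
    rcases eq_or_ne j i with rfl | hne
    · simp [hzi]
    · simp [hne]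
  simpa using add_mem h1 (mem_recession_of_sum hf hf0 hi hβ)

/-! ### A single block of the extended formulation -/

/-- Every point of `conv (Q_ℓ \ {0})` may be paired with `(x eᵢ, f x)`, for any index `i` of the
component: the slice of the closed convex hull over `(x eᵢ, f x)` is convex, and it contains every
nonzero point of `Q_ℓ` because the mass `x` can be moved from the support of that point to `i`. -/
theorem mem_closure_of_mem_convexHull_diff (hf : ConvexOn ℝ Set.univ f) (hf0 : f 0 = 0)
    (hQ : ∀ z ∈ Q, ∀ i, z i = 0 ∨ z i = 1) {c : (indexGraph Q).ConnectedComponent} {i : Fin p}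
    (hi : i ∈ c.supp) {w : Fin p → ℝ} (hw : w ∈ convexHull ℝ (restrictTo Q c.supp \ {0}))
    (x : ℝ) : (w, Pi.single i x, f x) ∈ closure (convexHull ℝ (ZSet f Q)) := by
  have hconv : Convex ℝ {w : Fin p → ℝ |
      (w, Pi.single i x, f x) ∈ closure (convexHull ℝ (ZSet f Q))} := by
    intro w hw w' hw' a b ha hb hab
    have h := convex_closure_convexHull_ZSet hw hw' ha hb hab
    have hβ : a • Pi.single i x + b • Pi.single i x = (Pi.single i x : Fin p → ℝ) := by
      rw [← add_smul, hab, one_smul]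
    have ht : a * f x + b * f x = f x := by rw [← add_mul, hab, one_mul]
    simpa only [Set.mem_ofPred_eq, Prod.smul_mk, Prod.mk_add_mk, hβ, ht, smul_eq_mul] using h
  refine convexHull_min (fun z hz => ?_) hconv hw
  obtain ⟨j, hj, hzj⟩ := eq_one_of_mem_restrictTo_diff hQ hz
  have h1 : (z, Pi.single j x, f x) ∈ ZSet f Q := by
    refine ⟨hz.1.1, by simp, fun l => ?_⟩
    rcases eq_or_ne l j with rfl | hne
    · simp [hzj]
    · simp [hne]
  have hreach : (indexGraph Q).Reachable j i := by
    rw [← SimpleGraph.ConnectedComponent.eq]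
    rw [SimpleGraph.ConnectedComponent.mem_supp_iff] at hi hj
    rw [hi, hj]
  simpa using mem_recession_of_reachable hf hf0 hreach x _ (subset_closure_convexHull_ZSet h1)

/-- A nonzero point of `conv Q_ℓ` is `s w` with `w ∈ conv (Q_ℓ \ {0})` and `s` so large that the
perspective at `s` is still bounded by `t`. Starting from any such representation with
`s < μ := min {1, πᵀz : π ∈ F}`, the point `z / μ` lies on the segment from `z` to `w`, hence in
`conv Q_ℓ`, and satisfies all the inequalities `πᵀ(z / μ) ≥ 1`, so `s` can be replaced by `μ`. -/
theorem exists_smul_mem_convexHull_diff (hf : ConvexOn ℝ Set.univ f) (hf0 : f 0 = 0)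
    {R : Set (Fin p → ℝ)} {F : Finset (Fin p → ℝ)}
    (hF : convexHull ℝ (R \ {0}) = convexHull ℝ R ∩ {z | ∀ π ∈ F, 1 ≤ ∑ i, π i * z i})
    {z : Fin p → ℝ} (hz : z ∈ convexHull ℝ R) (hz0 : z ≠ 0) {x t : ℝ} (h1 : f x ≤ t)
    (hπ : ∀ π ∈ F, persp f (∑ i, π i * z i) x ≤ (t : EReal)) :
    ∃ (s : ℝ) (w : Fin p → ℝ), 0 < s ∧ s ≤ 1 ∧ (s < 1 → 0 ∈ R) ∧ w ∈ convexHull ℝ (R \ {0}) ∧ z = s • w ∧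
      persp f s x ≤ (t : EReal) := by
  by_cases h0 : (0 : Fin p → ℝ) ∈ R
  swap
  · rw [← Set.sdiff_singleton_eq_self h0] at hz
    exact ⟨1, z, one_pos, le_rfl, fun h => absurd h (lt_irrefl 1), hz, by simp,
      by simpa [persp_one] using h1⟩
  have hrep : ∃ (s : ℝ) (w : Fin p → ℝ), 0 < s ∧ s ≤ 1 ∧ w ∈ convexHull ℝ (R \ {0}) ∧ z = s • w := by
    have hne : (R \ {0}).Nonempty := by
      by_contra hne
      rw [Set.not_nonempty_iff_eq_empty, Set.sdiff_eq_empty] at hne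
      have := convexHull_mono hne hz
      exact hz0 (by simpa using this)
    rw [← Set.insert_sdiff_self_of_mem h0, convexHull_insert hne, mem_convexJoin] at hz
    obtain ⟨_, rfl, w, hw, a, b, ha, hb, hab, rfl⟩ := hz
    refine ⟨b, w, lt_of_le_of_ne hb fun h => hz0 ?_, by linarith, hw, by simp⟩
    simp [← h]
  obtain ⟨s, w, hs0, hs1, hw, hzw⟩ := hrep
  -- `μ` is the least of the numbers at which the perspective is known to be at most `t`.
  obtain ⟨μ, hμ, hμmin⟩ := Finset.exists_min_image
    (insert 1 (F.image fun π => ∑ i, π i * z i)) id ⟨1, by simp⟩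
  have hμt : persp f μ x ≤ (t : EReal) := by
    simp only [Finset.mem_insert, Finset.mem_image] at hμ
    rcases hμ with rfl | ⟨π, hπF, rfl⟩
    · simpa [persp_one] using h1
    · exact hπ π hπF
  have hμ1 : μ ≤ 1 := hμmin 1 (by simp)
  have hμF : ∀ π ∈ F, μ ≤ ∑ i, π i * z i := fun π hπF =>
    hμmin _ (Finset.mem_insert_of_mem (Finset.mem_image_of_mem _ hπF))
  rcases le_or_gt μ s with hμs | hsμ
  · exact ⟨s, w, hs0, hs1, fun _ => h0, hw, hzw, persp_le_coe_of_le hf hf0 hμs hμt⟩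
  have hμ0 : 0 < μ := hs0.trans hsμ
  refine ⟨μ, μ⁻¹ • z, hμ0, hμ1, fun _ => h0, ?_, by simp [smul_smul, hμ0.ne'], hμt⟩
  rw [hF]
  refine ⟨?_, fun π hπF => ?_⟩
  · have hwR : w ∈ convexHull ℝ R := convexHull_mono Set.sdiff_subset hw
    have h0R : (0 : Fin p → ℝ) ∈ convexHull ℝ R := subset_convexHull ℝ R h0
    have hle : μ⁻¹ * s ≤ 1 := by
      rw [inv_mul_le_iff₀ hμ0]
      linarith
    have := convex_convexHull ℝ R hwR h0R (a := μ⁻¹ * s) (b := 1 - μ⁻¹ * s) (by positivity)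
      (sub_nonneg.2 hle) (by ring)
    simpa [hzw, smul_smul] using this
  · have : ∑ i, π i * (μ⁻¹ • z) i = μ⁻¹ * ∑ i, π i * z i := by
      rw [Finset.mul_sum]
      exact Finset.sum_congr rfl fun i _ => by simp; ring
    rw [this, ← div_eq_inv_mul, one_le_div hμ0]
    exact hμF π hπF

/-- A block with `α = 1` lies in the closed convex hull. -/
theorem mem_closure_of_block (hf : ConvexOn ℝ Set.univ f) (hf0 : f 0 = 0)
    (hQ : ∀ z ∈ Q, ∀ i, z i = 0 ∨ z i = 1) (hcover : ∀ i, ∃ z ∈ Q, z i = 1)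
    {c : (indexGraph Q).ConnectedComponent} {F : Finset (Fin p → ℝ)}
    (hF : convexHull ℝ (restrictTo Q c.supp \ {0}) =
      convexHull ℝ (restrictTo Q c.supp) ∩ {z | ∀ π ∈ F, 1 ≤ ∑ i, π i * z i})
    {z β : Fin p → ℝ} {t : ℝ} (hz : z ∈ convexHull ℝ (restrictTo Q c.supp))
    (hβ : ∀ j, j ∉ c.supp → β j = 0) (h1 : f (∑ i, β i) ≤ t)
    (hπ : ∀ π ∈ F, persp f (∑ i, π i * z i) (∑ i, β i) ≤ (t : EReal)) :
    (z, β, t) ∈ closure (convexHull ℝ (ZSet f Q)) := by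
  have hzero : (0 : Fin p → ℝ) ∈ restrictTo Q c.supp →
      (0 : (Fin p → ℝ) × (Fin p → ℝ) × ℝ) ∈ closure (convexHull ℝ (ZSet f Q)) := fun h =>
    subset_closure_convexHull_ZSet ⟨h.1, by simp [hf0], by simp⟩
  have hnot := zero_notMem_convexHull_restrictTo_diff (V := c.supp) hQ
  rcases eq_or_ne z 0 with rfl | hz0
  · have h0 : (0 : Fin p → ℝ) ∈ restrictTo Q c.supp := by
      by_contra h0
      rw [Set.sdiff_singleton_eq_self h0] at hnot
      exact hnot hz
    -- `F` is nonempty: it has to cut `0` off.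
    obtain ⟨π, hπF, -⟩ : ∃ π ∈ F, ¬ 1 ≤ ∑ i, π i * (0 : Fin p → ℝ) i := by
      by_contra! h
      exact hnot (hF ▸ ⟨hz, h⟩)
    have hrec := mem_recession_of_persp_zero hf hf0 hcover hβ (by simpa using hπ π hπF)
    simpa using hrec _ (hzero h0)
  · obtain ⟨s, w, hs0, hs1, hsR, hw, rfl, hst⟩ :=
      exists_smul_mem_convexHull_diff hf hf0 hF hz hz0 h1 hπ
    obtain ⟨i, hi⟩ := c.nonempty_supp
    set y := ∑ i, β i with hy
    have hC := mem_closure_of_mem_convexHull_diff hf hf0 hQ hi hw (y / s)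
    have hsC : (s • w, Pi.single i y, s * f (y / s)) ∈ closure (convexHull ℝ (ZSet f Q)) := by
      have hβs : s • (Pi.single i (y / s) : Fin p → ℝ) = Pi.single i y := by
        rw [← Pi.single_smul, smul_eq_mul, mul_div_cancel₀ _ hs0.ne']
      rcases hs1.eq_or_lt with rfl | hlt
      · simpa using hC
      · have := convex_closure_convexHull_ZSet (hzero (hsR hlt)) hC (sub_nonneg.2 hs1) hs0.le
          (by ring)
        simpa [hβs] using this
    have hmass := mem_recession_of_sum hf hf0 hi hβ
    have hst' : s * f (y / s) ≤ t := by
      simpa only [persp, hs0, if_true, EReal.coe_le_coe_iff] using hst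
    have hup : ((0, 0, t - s * f (y / s)) : (Fin p → ℝ) × (Fin p → ℝ) × ℝ) ∈
        recessionDirections (closure (convexHull ℝ (ZSet f Q))) :=
      mem_recession_of_persp_zero hf hf0 hcover (c := c) (fun _ _ => rfl)
        (by simpa using persp_zero_zero_le_coe hf hf0 (sub_nonneg.2 hst'))
    simpa [hy] using add_mem hmass hup _ hsC

end

/-! ### The closed convex hull -/

section
variable {p k : ℕ} {f : ℝ → ℝ} {Q : Set (Fin p → ℝ)}
  {comp : Fin k ≃ (indexGraph Q).ConnectedComponent} {m : Fin k → ℕ}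
  {A : ∀ ℓ, Matrix (Fin (m ℓ)) (Fin p) ℝ} {δ : ∀ ℓ, Fin (m ℓ) → ℝ}
  {F : Fin k → Finset (Fin p → ℝ)}

theorem pairwise_disjoint_supp (comp : Fin k ≃ (indexGraph Q).ConnectedComponent) :
    Pairwise fun ℓ ℓ' => Disjoint (comp ℓ).supp (comp ℓ').supp := by
  intro ℓ ℓ' hne
  refine Set.disjoint_left.2 fun i hi hi' => hne (comp.injective ?_)
  rw [SimpleGraph.ConnectedComponent.mem_supp_iff] at hi hi'
  rw [← hi, hi']

theorem exists_mem_restrictTo (hp : 1 ≤ p) (hQ : ∀ z ∈ Q, ∀ i, z i = 0 ∨ z i = 1)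
    (comp : Fin k ≃ (indexGraph Q).ConnectedComponent) {z : Fin p → ℝ} (hz : z ∈ Q) :
    ∃ ℓ, z ∈ restrictTo Q (comp ℓ).supp := by
  by_cases h : ∃ i, z i = 1
  · obtain ⟨i, hi⟩ := h
    refine ⟨comp.symm ((indexGraph Q).connectedComponentMk i),
      mem_restrictTo_supp hQ hz hi ?_⟩
    simp [SimpleGraph.ConnectedComponent.mem_supp_iff]
  · push Not at h
    exact ⟨comp.symm ((indexGraph Q).connectedComponentMk ⟨0, hp⟩), hz, fun i _ =>
      (hQ z hz i).resolve_right (h i)⟩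

/-- A point `(z, β, t)` of `Z_Q` uses only the block of a component that contains the support of
`z`, with `α = 1` there; all the other blocks vanish. -/
theorem ZSet_subset_proj (hp : 1 ≤ p) (hf : ConvexOn ℝ Set.univ f) (hf0 : f 0 = 0)
    (hQ : ∀ z ∈ Q, ∀ i, z i = 0 ∨ z i = 1)
    (hA : ∀ ℓ, convexHull ℝ (restrictTo Q (comp ℓ).supp) =
      {z | Matrix.mulVec (A ℓ) z ≤ δ ℓ})
    (hF : ∀ ℓ, convexHull ℝ (restrictTo Q (comp ℓ).supp \ {0}) =
      convexHull ℝ (restrictTo Q (comp ℓ).supp) ∩ {z | ∀ π ∈ F ℓ, 1 ≤ ∑ i, π i * z i}) :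
    ZSet f Q ⊆ ExtVars.proj '' extendedFormulation f (fun ℓ => (comp ℓ).supp) A δ F := by
  rintro ⟨z, β, t⟩ ⟨hz, ht, hβ⟩
  simp only at hz ht hβ
  obtain ⟨ℓ, hzℓ⟩ := exists_mem_restrictTo hp hQ comp hz
  have hβ0 : ∀ i, z i = 0 → β i = 0 := fun i hi => by simpa [hi] using hβ i
  have hz01 : ∀ i, z i ∈ Set.Icc (0 : ℝ) 1 := fun i => by
    rcases hQ z hz i with h | h <;> simp [h]
  rw [proj_image_extendedFormulation]
  refine ⟨(Pi.single ℓ z, Pi.single ℓ β, Pi.single ℓ 1, Pi.single ℓ t),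
    ⟨?_, ?_, ?_, ?_, ?_, rfl, rfl, rfl, ?_, ?_, ?_⟩, ?_⟩ <;>
    simp only [ExtVars.ofBlocks, ExtVars.proj, Finset.sum_pi_single', Finset.mem_univ, if_true]
  · exact hz01
  · intro ℓ' i
    rcases eq_or_ne ℓ' ℓ with rfl | hne
    · simpa using hz01 i
    · simp [hne]
  · intro ℓ'
    rcases eq_or_ne ℓ' ℓ with rfl | hne
    · simp
    · simp [hne]
  · intro ℓ' i hi
    rcases eq_or_ne ℓ' ℓ with rfl | hne
    · simpa using hβ0 i (hzℓ.2 i hi)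
    · simp [hne]
  · intro ℓ'
    rcases eq_or_ne ℓ' ℓ with rfl | hne
    · have := hA ℓ' ▸ subset_convexHull ℝ _ hzℓ
      simpa using this
    · simp [hne]
  · intro ℓ'
    rcases eq_or_ne ℓ' ℓ with rfl | hne
    · simpa [persp_one] using ht
    · simpa [hne] using persp_zero_zero_le_coe hf hf0 le_rfl
  · intro ℓ' π hπ
    rcases eq_or_ne ℓ' ℓ with rfl | hne
    · simp only [Pi.single_eq_same]
      by_cases hz0 : z = 0
      · have hβ' : ∀ i, β i = 0 := fun i => hβ0 i (by simp [hz0])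
        simp only [hβ', Finset.sum_const_zero, hf0] at ht
        simpa [hz0, hβ'] using persp_zero_zero_le_coe hf hf0 ht
      · have h := subset_convexHull ℝ (restrictTo Q (comp ℓ').supp \ {0}) ⟨hzℓ, hz0⟩
        rw [hF] at h
        exact persp_le_coe_of_le hf hf0 (h.2 π hπ) (by simpa [persp_one] using ht)
    · simpa [hne] using persp_zero_zero_le_coe hf hf0 le_rfl

/-- A recession direction `z ≥ 0` of a polytope in the unit cube vanishes. -/
theorem eq_zero_of_mulVec_le_zero (hQ : ∀ z ∈ Q, ∀ i, z i = 0 ∨ z i = 1) {V : Set (Fin p)}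
    {n : ℕ} {M : Matrix (Fin n) (Fin p) ℝ} {b : Fin n → ℝ}
    (hM : convexHull ℝ (restrictTo Q V) = {z | Matrix.mulVec M z ≤ b})
    (hne : (restrictTo Q V).Nonempty) {z : Fin p → ℝ} (hz0 : ∀ i, 0 ≤ z i)
    (hz : Matrix.mulVec M z ≤ 0) : z = 0 := by
  obtain ⟨q, hq⟩ := hne
  have hcube : convexHull ℝ (restrictTo Q V) ⊆ Set.Icc 0 1 :=
    convexHull_min (fun x hx => ⟨fun i => by rcases hQ x hx.1 i with h | h <;> simp [h],
      fun i => by rcases hQ x hx.1 i with h | h <;> simp [h]⟩) (convex_Icc 0 1)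
  have hq' : Matrix.mulVec M q ≤ b := by
    have h := subset_convexHull ℝ _ hq
    rwa [hM] at h
  ext i
  refine le_antisymm (le_of_not_gt fun hi => ?_) (hz0 i)
  have hmem : q + (2 / z i) • z ∈ convexHull ℝ (restrictTo Q V) := by
    rw [hM]
    intro j
    have h2 := mul_nonpos_of_nonneg_of_nonpos (div_nonneg zero_le_two (hz0 i)) (hz j)
    simp only [Matrix.mulVec_add, Matrix.mulVec_smul, Pi.add_apply, Pi.smul_apply, smul_eq_mul]
    linarith [hq' j]
  have h1 := (hcube hmem).2 i
  have h0 := (hcube (subset_convexHull ℝ _ hq)).1 i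
  simp only [Pi.add_apply, Pi.smul_apply, smul_eq_mul, Pi.one_apply, Pi.zero_apply] at h0 h1
  rw [div_mul_cancel₀ _ (ne_of_gt hi)] at h1
  linarith

/-- The block of weight `a` is `a` times a point of the closed convex hull plus a recession
direction; the latter carries the whole block when `a = 0`. -/
theorem exists_add_recession_of_block (hf : ConvexOn ℝ Set.univ f) (hf0 : f 0 = 0)
    (hQ : ∀ z ∈ Q, ∀ i, z i = 0 ∨ z i = 1) (hcover : ∀ i, ∃ z ∈ Q, z i = 1)
    {c : (indexGraph Q).ConnectedComponent} {n : ℕ} {M : Matrix (Fin n) (Fin p) ℝ}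
    {b : Fin n → ℝ} {G : Finset (Fin p → ℝ)}
    (hM : convexHull ℝ (restrictTo Q c.supp) = {z | Matrix.mulVec M z ≤ b})
    (hG : convexHull ℝ (restrictTo Q c.supp \ {0}) =
      convexHull ℝ (restrictTo Q c.supp) ∩ {z | ∀ π ∈ G, 1 ≤ ∑ i, π i * z i})
    {z β : Fin p → ℝ} {a t : ℝ} (ha : 0 ≤ a) (hz0 : ∀ i, 0 ≤ z i)
    (hβ : ∀ j, j ∉ c.supp → β j = 0) (hz : Matrix.mulVec M z ≤ a • b)
    (h1 : persp f a (∑ i, β i) ≤ (t : EReal))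
    (hπ : ∀ π ∈ G, persp f (∑ i, π i * z i) (∑ i, β i) ≤ (t : EReal)) :
    ∃ x ∈ closure (convexHull ℝ (ZSet f Q)),
      ∃ d ∈ recessionDirections (closure (convexHull ℝ (ZSet f Q))), (z, β, t) = a • x + d := by
  obtain ⟨i, hi⟩ := c.nonempty_supp
  obtain ⟨q, hq, hqi⟩ := hcover i
  rcases ha.eq_or_lt with rfl | ha
  · rw [zero_smul] at hz
    obtain rfl := eq_zero_of_mulVec_le_zero hQ hM ⟨q, mem_restrictTo_supp hQ hq hqi hi⟩ hz0 hz
    refine ⟨(q, 0, 0), subset_closure_convexHull_ZSet ⟨hq, by simp [hf0], by simp⟩, _,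
      mem_recession_of_persp_zero hf hf0 hcover hβ h1, by simp⟩
  · have ha' := inv_nonneg.2 ha.le
    have hsum : ∑ i, (a⁻¹ • β) i = a⁻¹ * ∑ i, β i := by simp [Finset.mul_sum]
    refine ⟨(a⁻¹ • z, a⁻¹ • β, a⁻¹ * t), mem_closure_of_block hf hf0 hQ hcover hG ?_ ?_ ?_ ?_,
      0, zero_mem _, by simp [smul_smul, ha.ne']⟩
    · rw [hM]
      intro j
      have h := mul_le_mul_of_nonneg_left (hz j) ha'
      simp only [Pi.smul_apply, smul_eq_mul, inv_mul_cancel_left₀ ha.ne'] at h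
      simpa [Matrix.mulVec_smul] using h
    · intro j hj
      simp [hβ j hj]
    · have h := persp_mul_le_coe hf hf0 ha' h1
      rwa [inv_mul_cancel₀ ha.ne', persp_one, EReal.coe_le_coe_iff, ← hsum] at h
    · intro π hπG
      have h := persp_mul_le_coe hf hf0 ha' (hπ π hπG)
      have hπz : ∑ i, π i * (a⁻¹ • z) i = a⁻¹ * ∑ i, π i * z i := by
        rw [Finset.mul_sum]
        exact Finset.sum_congr rfl fun i _ => by simp; ring
      rwa [hsum, hπz]

end

theorem theorem2 (p : ℕ) (hp : 1 ≤ p)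
    (f : ℝ → ℝ) (hf : ConvexOn ℝ Set.univ f) (hf0 : f 0 = 0)
    (Q : Set (Fin p → ℝ)) (hQ : ∀ z ∈ Q, ∀ i, z i = 0 ∨ z i = 1)
    (hcover : ∀ i, ∃ z ∈ Q, z i = 1)
    (k : ℕ) (comp : Fin k ≃ (indexGraph Q).ConnectedComponent)
    (m : Fin k → ℕ) (A : ∀ ℓ, Matrix (Fin (m ℓ)) (Fin p) ℝ) (δ : ∀ ℓ, Fin (m ℓ) → ℝ)
    (hA : ∀ ℓ, convexHull ℝ (restrictTo Q (comp ℓ).supp) =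
      {z | Matrix.mulVec (A ℓ) z ≤ δ ℓ})
    (F : Fin k → Finset (Fin p → ℝ))
    (hF : ∀ ℓ, convexHull ℝ (restrictTo Q (comp ℓ).supp \ {0}) =
      convexHull ℝ (restrictTo Q (comp ℓ).supp) ∩ {z | ∀ π ∈ F ℓ, 1 ≤ ∑ i, π i * z i}) :
    closure (convexHull ℝ (ZSet f Q)) =
      ExtVars.proj '' extendedFormulation f (fun ℓ => (comp ℓ).supp) A δ F := by
  apply Set.Subset.antisymm
  · exact closure_minimal (convexHull_min (ZSet_subset_proj hp hf hf0 hQ hA hF)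
      (convex_proj_extendedFormulation hf hf0))
      (isClosed_proj_extendedFormulation hf hf0 (pairwise_disjoint_supp comp))
  · rw [proj_image_extendedFormulation]
    rintro _ ⟨⟨zh, βh, α, th⟩, ⟨-, h2, h3, h4, h5, -, -, -, h9, h10, h11⟩, rfl⟩
    simp only [ExtVars.ofBlocks] at h2 h3 h4 h5 h9 h10 h11
    choose x hx d hd heq using fun ℓ => exists_add_recession_of_block hf hf0 hQ hcover (hA ℓ)
      (hF ℓ) (h3 ℓ) (fun i => (h2 ℓ i).1) (h4 ℓ) (h9 ℓ) (h10 ℓ) (h11 ℓ)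
    have hsum : (ExtVars.ofBlocks (zh, βh, α, th)).proj = ∑ ℓ, α ℓ • x ℓ + ∑ ℓ, d ℓ := by
      rw [← Finset.sum_add_distrib, ← Finset.sum_congr rfl fun ℓ _ => heq ℓ]
      simp [ExtVars.ofBlocks, ExtVars.proj, Prod.ext_iff, Prod.fst_sum, Prod.snd_sum]
    simp only [hsum]
    exact sum_mem (fun ℓ _ => hd ℓ) _
      (convex_closure_convexHull_ZSet.sum_mem (fun ℓ _ => h3 ℓ) h5 fun ℓ _ => hx ℓ)
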